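/- Let $(\operatorname{sm},\operatorname{cm})$ be the Dixonian elliptic functions, i.e. the solution, analytic near $0$, of the system $\operatorname{sm}'(z)=\operatorname{cm}(z)^2$, $\operatorname{cm}'(z)=-\operatorname{sm}(z)^2$ with $\operatorname{sm}(0)=0$, $\operatorname{cm}(0)=1$, and put $\operatorname{smh}(z)=-\operatorname{sm}(-z)$. Let $\sigma=\sigma_1\sigma_2\cdots\sigma_n$ be a permutation of $\{1,\dots,n\}$ written as a word and bordered by $(-\infty,-\infty)$, that is, $\sigma_0=\sigma_{n+1}=-\infty$. A value $\sigma_j$ ($1\le j\le n$) is a peak if $\sigma_{j-1}<\sigma_j>\sigma_{j+1}$, a valley if $\sigma_{j-1}>\sigma_j<\sigma_{j+1}$, a double rise if $\sigma_{j-1}<\sigma_j<\sigma_{j+1}$, and a double fall if $\sigma_{j-1}>\sigma_j>\sigma_{j+1}$. The permutation is $3$-repeated if for each $j\ge 0$ the elements with value in $\{3j+1,3j+2,3j+3\}\cap\{1,\dots,n\}$ are all of the same one of these four types. A polarized $3$-repeated permutation of length $n=3\nu+1$ ($\nu\ge 0$) is a $3$-repeated permutation of length $n$ together with a (possibly empty,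 possibly full) set of marked factors, chosen among the factors of three consecutive letters of the word that are of the form $3j+3,\,3j+2,\,3j+1$ or $3j+1,\,3j+2,\,3j+3$ with $j\ge 0$. Theorem. Let $P_n$ be the number of polarized $3$-repeated permutations of length $n$ bordered by $(-\infty,-\infty)$ (so $P_n=0$ unless $n\equiv 1 \bmod 3$). Then the exponential generating function of polarized $3$-repeated permutations is $\operatorname{smh}$: $$\sum_{n\ge 0}P_n\frac{z^n}{n!}=\sum_{\nu\ge 0}P_{3\nu+1}\frac{z^{3\nu+1}}{(3\nu+1)!}=\operatorname{smh}(z),$$ both as an identity of formal power series with the Taylor series of $\operatorname{smh}$ at $0$ and as a convergent expansion in a neighbourhood of $0$ in $\mathbb{C}$. -/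

import Mathlib

open scoped Topology Nat PowerSeries

/-- The pair of coefficients of `z ^ n` in the formal solution of the system
`s' = c ^ 2`, `c' = - s ^ 2`, `s(0) = 0`, `c(0) = 1`. -/
def dixonCoeff : ℕ → ℚ × ℚ
  | 0 => (0, 1)
  | n + 1 =>
    ((∑ i : Fin (n + 1), (dixonCoeff i).2 * (dixonCoeff (n - i)).2) / (n + 1),
      -(∑ i : Fin (n + 1), (dixonCoeff i).1 * (dixonCoeff (n - i)).1) / (n + 1))

/-- Taylor series at `0` of the Dixonian elliptic function `sm`. -/
def smSeries : ℚ⟦X⟧ := PowerSeries.mk fun n => (dixonCoeff n).1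

/-- Taylor series at `0` of the Dixonian elliptic function `cm`. -/
def cmSeries : ℚ⟦X⟧ := PowerSeries.mk fun n => (dixonCoeff n).2

theorem constantCoeff_smSeries : PowerSeries.constantCoeff smSeries = 0 := by
  rw [← PowerSeries.coeff_zero_eq_constantCoeff_apply, smSeries, PowerSeries.coeff_mk, dixonCoeff]

theorem constantCoeff_cmSeries : PowerSeries.constantCoeff cmSeries = 1 := by
  rw [← PowerSeries.coeff_zero_eq_constantCoeff_apply, cmSeries, PowerSeries.coeff_mk, dixonCoeff]

theorem derivative_smSeries : PowerSeries.derivative ℚ smSeries = cmSeries ^ 2 := by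
  ext n
  have h : (n : ℚ) + 1 ≠ 0 := by positivity
  rw [PowerSeries.coeff_derivative, sq, PowerSeries.coeff_mul,
    Finset.Nat.sum_antidiagonal_eq_sum_range_succ_mk, Finset.sum_range]
  simp only [smSeries, cmSeries, PowerSeries.coeff_mk]
  rw [dixonCoeff]
  field_simp

theorem derivative_cmSeries : PowerSeries.derivative ℚ cmSeries = -smSeries ^ 2 := by
  ext n
  have h : (n : ℚ) + 1 ≠ 0 := by positivity
  rw [PowerSeries.coeff_derivative, map_neg, sq, PowerSeries.coeff_mul,
    Finset.Nat.sum_antidiagonal_eq_sum_range_succ_mk, Finset.sum_range]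
  simp only [smSeries, cmSeries, PowerSeries.coeff_mk]
  rw [dixonCoeff]
  field_simp

/-- Taylor series at `0` of `smh(z) = - sm(-z)`. -/
noncomputable def smhSeries : ℚ⟦X⟧ := -PowerSeries.rescale (-1 : ℚ) smSeries

/-- `s` and `c` are (germs at `0` of) the Dixonian functions `sm` and `cm`: they solve
`s' = c ^ 2`, `c' = - s ^ 2` near `0`, with `s(0) = 0` and `c(0) = 1`. -/
def IsDixonPair (s c : ℂ → ℂ) : Prop :=
  s 0 = 0 ∧ c 0 = 1 ∧
    ∀ᶠ z in 𝓝 (0 : ℂ), HasDerivAt s (c z ^ 2) z ∧ HasDerivAt c (-(s z) ^ 2) z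

/-- A permutation `σ` of `Fin n` is written as the word `w₁ w₂ ⋯ wₙ` on `{1, …, n}` with
`wⱼ = σ (j - 1) + 1`. The word is bordered by `(-∞, -∞)`: `w₀ = wₙ₊₁ = ⊥`. -/
def borderedWord {n : ℕ} (σ : Equiv.Perm (Fin n)) (j : ℕ) : WithBot ℕ :=
  if h : 1 ≤ j ∧ j ≤ n then (((σ ⟨j - 1, by omega⟩ : ℕ) + 1 : ℕ) : WithBot ℕ) else ⊥

/-- The four local ordinal types. -/
inductive OrdinalType
  | peak
  | valley
  | doubleRise
  | doubleFall

/-- The letter in position `j ≥ 1` of the bordered word of `σ` has ordinal type `t`. -/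
def HasOrdinalType {n : ℕ} (σ : Equiv.Perm (Fin n)) (j : ℕ) (t : OrdinalType) : Prop :=
  match t with
  | .peak => borderedWord σ (j - 1) < borderedWord σ j ∧ borderedWord σ (j + 1) < borderedWord σ j
  | .valley => borderedWord σ j < borderedWord σ (j - 1) ∧ borderedWord σ j < borderedWord σ (j + 1)
  | .doubleRise =>
      borderedWord σ (j - 1) < borderedWord σ j ∧ borderedWord σ j < borderedWord σ (j + 1)
  | .doubleFall =>
      borderedWord σ j < borderedWord σ (j - 1) ∧ borderedWord σ (j + 1) < borderedWord σ j

/-- `σ`, bordered by `(-∞, -∞)`, is `r`-repeated: for each `k ≥ 0` the values in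
`{k r + 1, …, k r + r} ∩ {1, …, n}` are all of the same ordinal type. -/
def IsRepeated (r : ℕ) {n : ℕ} (σ : Equiv.Perm (Fin n)) : Prop :=
  ∀ k : ℕ, ∃ t : OrdinalType, ∀ j v : ℕ,
    borderedWord σ j = (v : WithBot ℕ) → k * r + 1 ≤ v → v ≤ k * r + r → HasOrdinalType σ j t

/-- The three consecutive letters of the word of `σ` that start in position `i + 1` are
`3k+3, 3k+2, 3k+1` or `3k+1, 3k+2, 3k+3` for some `k ≥ 0`. -/
def IsMarkable {n : ℕ} (σ : Equiv.Perm (Fin n)) (i : Fin n) : Prop :=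
  ∃ k : ℕ,
    (borderedWord σ (i + 1) = ((3 * k + 3 : ℕ) : WithBot ℕ) ∧
      borderedWord σ (i + 2) = ((3 * k + 2 : ℕ) : WithBot ℕ) ∧
      borderedWord σ (i + 3) = ((3 * k + 1 : ℕ) : WithBot ℕ)) ∨
    (borderedWord σ (i + 1) = ((3 * k + 1 : ℕ) : WithBot ℕ) ∧
      borderedWord σ (i + 2) = ((3 * k + 2 : ℕ) : WithBot ℕ) ∧
      borderedWord σ (i + 3) = ((3 * k + 3 : ℕ) : WithBot ℕ))

/-- The polarized `3`-repeated permutations of length `n` bordered by `(-∞, -∞)`: pairs `(σ, M)`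
of a `3`-repeated permutation `σ`, whose length `n` is of the form `3ν + 1`, and a set `M` of
marked factors, each given by its starting position, all of them markable. -/
def PolarizedPerm (n : ℕ) : Type :=
  {p : Equiv.Perm (Fin n) × Finset (Fin n) //
    (∃ ν : ℕ, n = 3 * ν + 1) ∧ IsRepeated 3 p.1 ∧ ∀ i ∈ p.2, IsMarkable p.1 i}

instance instFinitePolarizedPerm (n : ℕ) : Finite (PolarizedPerm n) :=
  inferInstanceAs (Finite {p : Equiv.Perm (Fin n) × Finset (Fin n) //
    (∃ ν : ℕ, n = 3 * ν + 1) ∧ IsRepeated 3 p.1 ∧ ∀ i ∈ p.2, IsMarkable p.1 i})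

/-- The exponential generating function of a combinatorial class with `a n` objects of size `n`. -/
def expGenFun (a : ℕ → ℕ) : ℚ⟦X⟧ := PowerSeries.mk fun n => (a n : ℚ) / (n ! : ℚ)

/-! Both sides satisfy the recursion of `pathWeight`. On the analytic side, `smh' = cmh ^ 2`, `cmh'
= smh ^ 2` and the Fermat cubic `cmh ^ 3 = 1 + smh ^ 3` express the third derivative of `smh ^ h`
through `smh ^ (h + 3)`, `smh ^ h` and `smh ^ (h - 3)` (`derivative_three_smhSeries_pow`). Reading
off coefficients, `(3m+1)!` times the coefficient of `z ^ (3m+1)` in `smh ^ h` is `pathWeight m h`.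

On the combinatorial side, the letters of a permutation are deleted from the smallest up. Deletion
turns an `h`-tuple of nonempty words into an `(h + a + d - 1)`-tuple, where `a` and `d` record
whether the deleted letter has a larger neighbour before and after it; `(a, d)` is exactly its
ordinal type, and the word containing it can be any of the `h`. Three successive letters of equal
type change `h` by 3 (valleys, `h(h+1)(h+2)` choices), by -3 (peaks, `h(h-1)(h-2)`), or by 0 (rises
or falls, `h^3` choices each). In the last case the three letters form a factor exactly when the
three word numbers agree; the optional mark counts those `h` choices twice, which gives `h^3 + h`.
This is `sum_prod_blockWeight`; a permutation is the case `h = 1`. -/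

/-- Weighted number of lattice paths with `m` steps `+3`, `0`, `-3` from height `h` to height `1`. -/
def pathWeight : ℕ → ℕ → ℕ
  | 0, h => if h = 1 then 1 else 0
  | m + 1, h => h * (h + 1) * (h + 2) * pathWeight m (h + 3) + 2 * (h * (h * h + 1)) * pathWeight m h +
      h * (h - 1) * (h - 2) * pathWeight m (h - 3)

/-! ### Formal series: third derivatives of powers of `smhSeries`. -/

theorem PowerSeries.derivative_rescale {R : Type*} [CommRing R] (a : R) (f : R⟦X⟧) :
    PowerSeries.derivative R (PowerSeries.rescale a f) =
      PowerSeries.C a * PowerSeries.rescale a (PowerSeries.derivative R f) := by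
  ext n
  simp only [PowerSeries.coeff_derivative, PowerSeries.coeff_rescale, PowerSeries.coeff_C_mul]
  ring

/-- Taylor series at `0` of `cm(-z)`. -/
noncomputable def cmhSeries : ℚ⟦X⟧ := PowerSeries.rescale (-1 : ℚ) cmSeries

theorem derivative_smhSeries : PowerSeries.derivative ℚ smhSeries = cmhSeries ^ 2 := by
  rw [smhSeries, map_neg, PowerSeries.derivative_rescale, derivative_smSeries, cmhSeries]
  simp

theorem derivative_cmhSeries : PowerSeries.derivative ℚ cmhSeries = smhSeries ^ 2 := by
  rw [cmhSeries, PowerSeries.derivative_rescale, derivative_cmSeries, smhSeries]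
  simp

theorem constantCoeff_smhSeries : PowerSeries.constantCoeff smhSeries = 0 := by
  rw [smhSeries, map_neg, ← PowerSeries.coeff_zero_eq_constantCoeff_apply,
    PowerSeries.coeff_rescale, PowerSeries.coeff_zero_eq_constantCoeff_apply,
    constantCoeff_smSeries]
  simp

theorem constantCoeff_cmhSeries : PowerSeries.constantCoeff cmhSeries = 1 := by
  rw [cmhSeries, ← PowerSeries.coeff_zero_eq_constantCoeff_apply,
    PowerSeries.coeff_rescale, PowerSeries.coeff_zero_eq_constantCoeff_apply,
    constantCoeff_cmSeries]
  simp

theorem cmhSeries_cube : cmhSeries ^ 3 = 1 + smhSeries ^ 3 := by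
  apply PowerSeries.derivative.ext
  · rw [map_add, PowerSeries.derivative_one, PowerSeries.derivative_pow,
      PowerSeries.derivative_pow, derivative_smhSeries, derivative_cmhSeries]
    push_cast
    ring
  · simp [constantCoeff_smhSeries, constantCoeff_cmhSeries]

/-- Three derivations leave only powers of `cmh ^ 3`, which the cubic relation eliminates. The
truncated `h - 3` is harmless, since its coefficient vanishes for `h < 3`. -/
theorem derivative_three_smhSeries_pow (h : ℕ) :
    PowerSeries.derivative ℚ (PowerSeries.derivative ℚ (PowerSeries.derivative ℚ
      (smhSeries ^ h))) =
      ((h * (h + 1) * (h + 2) : ℕ) : ℚ⟦X⟧) * smhSeries ^ (h + 3) +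
        ((2 * (h * (h * h + 1)) : ℕ) : ℚ⟦X⟧) * smhSeries ^ h +
        ((h * (h - 1) * (h - 2) : ℕ) : ℚ⟦X⟧) * smhSeries ^ (h - 3) := by
  have hD : ∀ k : ℕ, PowerSeries.derivative ℚ (k : ℚ⟦X⟧) = 0 := fun k => by
    simp
  have hc := cmhSeries_cube
  rcases h with _ | _ | _ | h
  all_goals
    simp only [PowerSeries.derivative_pow, Derivation.leibniz, derivative_smhSeries,
      derivative_cmhSeries, map_add, hD, smul_eq_mul, Nat.add_sub_cancel, zero_add]
    push_cast
  · simp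
  · simp
    linear_combination (4 * smhSeries) * hc
  · simp
    linear_combination (20 * smhSeries ^ 2) * hc
  · rw [map_zero]
    -- The first multiplier replaces `cmh ^ 6` by `(1 + smh ^ 3) ^ 2` as a difference of squares;
    -- the second replaces the single `cmh ^ 3`, whose coefficient for exponent `k` is `6k^2 - 2k`.
    linear_combination (((h : ℚ⟦X⟧) + 3) * (h + 2) * (h + 1) * smhSeries ^ h *
      (cmhSeries ^ 3 + 1 + smhSeries ^ 3) +
      (6 * ((h : ℚ⟦X⟧) + 3) ^ 2 - 2 * (h + 3)) * smhSeries ^ (h + 3)) * hc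

theorem coeff_smhSeries_pow_mul_factorial (m h : ℕ) :
    PowerSeries.coeff (3 * m + 1) (smhSeries ^ h) * ((3 * m + 1)! : ℚ) = pathWeight m h := by
  induction m generalizing h with
  | zero =>
    -- The coefficient of `z` is the derivative at 0, namely `h * 0 ^ (h - 1)`.
    have h1 := PowerSeries.coeff_derivative (R := ℚ) (smhSeries ^ h) 0
    rw [PowerSeries.derivative_pow, derivative_smhSeries,
      PowerSeries.coeff_zero_eq_constantCoeff_apply, map_mul, map_mul, map_pow, map_pow,
      constantCoeff_smhSeries, constantCoeff_cmhSeries] at h1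
    rcases h with _ | _ | h
    · simp [pathWeight, PowerSeries.coeff_one]
    · simpa [pathWeight] using h1.symm
    · simpa [pathWeight] using h1.symm
  | succ m ih =>
    have h1 := congrArg (PowerSeries.coeff (3 * m + 1)) (derivative_three_smhSeries_pow h)
    simp only [PowerSeries.coeff_derivative, map_add, ← map_natCast PowerSeries.C,
      PowerSeries.coeff_C_mul] at h1
    have hf : ((3 * (m + 1) + 1)! : ℚ) =
        ((3 * m + 1 : ℕ) + 1) * ((3 * m + 1 + 1 : ℕ) + 1) * ((3 * m + 1 + 1 + 1 : ℕ) + 1) *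
          ((3 * m + 1)! : ℚ) := by
      rw [show 3 * (m + 1) + 1 = 3 * m + 1 + 1 + 1 + 1 by ring, Nat.factorial_succ,
        Nat.factorial_succ, Nat.factorial_succ]
      push_cast
      ring
    rw [pathWeight, hf, show 3 * (m + 1) + 1 = 3 * m + 1 + 1 + 1 + 1 by ring]
    push_cast [← ih] at h1 ⊢
    linear_combination ((3 * m + 1)! : ℚ) * h1

/-- Residues mod 3 add under convolution: two exponents divisible by 3 feed `sm`, two exponents
congruent to 1 feed `cm`. -/
theorem dixonCoeff_eq_zero (n : ℕ) :
    (n % 3 ≠ 1 → (dixonCoeff n).1 = 0) ∧ (n % 3 ≠ 0 → (dixonCoeff n).2 = 0) := by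
  induction n using Nat.strong_induction_on with
  | _ n ih =>
    rcases n with _ | n
    · simp [dixonCoeff]
    rw [dixonCoeff]
    refine ⟨fun h => ?_, fun h => ?_⟩
    · dsimp only
      rw [Finset.sum_eq_zero, zero_div]
      intro i _
      by_cases hi : (i : ℕ) % 3 = 0
      · rw [(ih (n - i) (by omega)).2 (by omega), mul_zero]
      · rw [(ih i (by omega)).2 hi, zero_mul]
    · dsimp only
      rw [Finset.sum_eq_zero, neg_zero, zero_div]
      intro i _
      by_cases hi : (i : ℕ) % 3 = 1
      · rw [(ih (n - i) (by omega)).1 (by omega), mul_zero]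
      · rw [(ih i (by omega)).1 hi, zero_mul]

theorem coeff_smhSeries (n : ℕ) :
    PowerSeries.coeff n smhSeries = -((-1) ^ n * (dixonCoeff n).1) := by
  rw [smhSeries, map_neg, PowerSeries.coeff_rescale, smSeries, PowerSeries.coeff_mk]

/-! ### Analytic side: Taylor expansion of a Dixon pair. -/

/-- Leibniz' rule for `g * g`, with binomials absorbed by the factorials, reproduces the recursion
of `dixonCoeff`; the sign `ε` serves both equations of the system. -/
theorem iteratedDeriv_succ_mul_self {f g : ℂ → ℂ} {x ε : ℂ} (hg : AnalyticAt ℂ g x)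
    (h : ∀ᶠ z in 𝓝 x, HasDerivAt f (ε * g z ^ 2) z) (n : ℕ) (b : ℕ → ℂ)
    (hb : ∀ i ≤ n, iteratedDeriv i g x = i ! * b i) :
    iteratedDeriv (n + 1) f x = n ! * (ε * ∑ i : Fin (n + 1), b i * b (n - i)) := by
  have h1 : deriv f =ᶠ[𝓝 x] fun z => (ε * g z) * g z := h.mono fun z hz => by
    rw [hz.deriv]; ring
  have hc : ContDiffAt ℂ n g x := hg.contDiffAt
  rw [iteratedDeriv_succ', h1.iteratedDeriv_eq, iteratedDeriv_fun_mul (contDiffAt_const.mul hc) hc,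
    Finset.sum_range, Finset.mul_sum, Finset.mul_sum]
  refine Finset.sum_congr rfl fun i _ => ?_
  have hi : (i : ℕ) ≤ n := Nat.lt_succ_iff.1 i.2
  rw [iteratedDeriv_const_mul_field, hb i hi, hb (n - i) (Nat.sub_le _ _),
    ← Nat.choose_mul_factorial_mul_factorial hi]
  push_cast
  ring

theorem IsDixonPair.analyticAt {s c : ℂ → ℂ} (h : IsDixonPair s c) :
    AnalyticAt ℂ s 0 ∧ AnalyticAt ℂ c 0 :=
  ⟨Complex.analyticAt_iff_eventually_differentiableAt.2
      (h.2.2.mono fun _ hz => hz.1.differentiableAt),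
    Complex.analyticAt_iff_eventually_differentiableAt.2
      (h.2.2.mono fun _ hz => hz.2.differentiableAt)⟩

theorem IsDixonPair.iteratedDeriv_eq {s c : ℂ → ℂ} (h : IsDixonPair s c) (n : ℕ) :
    iteratedDeriv n s 0 = n ! * ((dixonCoeff n).1 : ℂ) ∧
      iteratedDeriv n c 0 = n ! * ((dixonCoeff n).2 : ℂ) := by
  induction n using Nat.strong_induction_on with
  | _ n ih =>
    rcases n with _ | n
    · simp [dixonCoeff, h.1, h.2.1]
    have hn : (n : ℂ) + 1 ≠ 0 := by exact_mod_cast n.succ_ne_zero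
    constructor
    · rw [iteratedDeriv_succ_mul_self (ε := 1) h.analyticAt.2
        (h.2.2.mono fun z hz => by simpa using hz.1) n (fun i => ((dixonCoeff i).2 : ℂ))
        fun i hi => (ih i (by omega)).2, dixonCoeff, Nat.factorial_succ]
      push_cast
      field_simp
    · rw [iteratedDeriv_succ_mul_self (ε := -1) h.analyticAt.1
        (h.2.2.mono fun z hz => by simpa using hz.2) n (fun i => ((dixonCoeff i).1 : ℂ))
        fun i hi => (ih i (by omega)).1, dixonCoeff, Nat.factorial_succ]
      push_cast
      field_simp

theorem IsDixonPair.hasSum_smhSeries {s c : ℂ → ℂ} (h : IsDixonPair s c) :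
    ∀ᶠ z in 𝓝 (0 : ℂ),
      HasSum (fun n : ℕ => ((PowerSeries.coeff n smhSeries : ℚ) : ℂ) * z ^ n) (-s (-z)) := by
  have h1 := hasFPowerSeriesAt_iff.1 h.analyticAt.1.hasFPowerSeriesAt
  have h2 : Filter.Tendsto (fun z : ℂ => -z) (𝓝 0) (𝓝 0) := by
    simpa using (continuous_neg (G := ℂ)).tendsto 0
  refine (h2.eventually h1).mono fun z hz => ?_
  rw [zero_add] at hz
  refine hz.neg.congr_fun ?_
  intro n
  have hn : (n ! : ℂ) ≠ 0 := by exact_mod_cast n.factorial_ne_zero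
  rw [coeff_smhSeries, FormalMultilinearSeries.coeff_ofScalars, (h.iteratedDeriv_eq n).1,
    neg_pow z, mul_div_cancel_left₀ _ hn]
  push_cast
  rw [smul_eq_mul]
  ring

/-! ### Tuples of words and insertion of a smallest letter. -/

/-- A list splits uniquely at its first entry satisfying `p`. This recovers both the word containing
an inserted letter and the place of that letter in it. -/
theorem List.append_cons_inj_of_forall_not {α : Type*} (p : α → Prop) {x₁ x₂ z₁ z₂ : List α}
    {a₁ a₂ : α} (h₁ : ∀ x ∈ x₁, ¬p x) (h₂ : ∀ x ∈ x₂, ¬p x) (ha₁ : p a₁) (ha₂ : p a₂)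
    (h : x₁ ++ a₁ :: z₁ = x₂ ++ a₂ :: z₂) : x₁ = x₂ ∧ a₁ = a₂ ∧ z₁ = z₂ := by
  induction x₁ generalizing x₂ with
  | nil =>
    rcases x₂ with _ | ⟨y, x₂⟩
    · simpa using h
    · simp only [List.nil_append, List.cons_append, List.cons.injEq] at h
      exact absurd (h.1 ▸ ha₁) (h₂ y (by simp))
  | cons y x₁ ih =>
    rcases x₂ with _ | ⟨y', x₂⟩
    · simp only [List.nil_append, List.cons_append, List.cons.injEq] at h
      exact absurd (h.1 ▸ ha₂) (h₁ y (by simp))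
    · simp only [List.cons_append, List.cons.injEq] at h
      obtain ⟨h3, h4⟩ := ih (fun x hx => h₁ x (by simp [hx])) (x₂ := x₂)
        (fun x hx => h₂ x (by simp [hx])) h.2
      exact ⟨by rw [h.1, h3], h4⟩

theorem List.pair_infix_append_cons_iff {α : Type*} {x y v : α} (hx : x ≠ v) (hy : y ≠ v)
    (l₁ l₂ : List α) : [x, y] <:+: l₁ ++ v :: l₂ ↔ [x, y] <:+: l₁ ∨ [x, y] <:+: l₂ := by
  induction l₁ with
  | nil =>
    simp only [List.nil_append, List.infix_cons_iff, List.cons_prefix_cons, hx, false_and,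
      false_or]
    simp
  | cons w l₁ ih =>
    rw [List.cons_append, List.infix_cons_iff, ih, List.infix_cons_iff, or_assoc]
    refine or_congr ?_ Iff.rfl
    rw [List.cons_prefix_cons, List.cons_prefix_cons]
    refine and_congr Iff.rfl ?_
    rcases l₁ with _ | ⟨w', l₁⟩ <;> simp [hy]

theorem List.pair_infix_append_cons_left_iff {α : Type*} {y v : α} {l₁ l₂ : List α}
    (h₁ : v ∉ l₁) (h₂ : v ∉ l₂) : [v, y] <:+: l₁ ++ v :: l₂ ↔ l₂.head? = some y := by
  induction l₁ with
  | nil =>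
    have h3 : ¬ [v, y] <:+: l₂ := fun h => h₂ (h.subset (by simp))
    rw [List.nil_append, List.infix_cons_iff, List.cons_prefix_cons]
    rcases l₂ with _ | ⟨w', l₂⟩ <;> simp [h3, eq_comm]
  | cons w l₁ ih =>
    simp only [List.mem_cons, not_or] at h₁
    rw [List.cons_append, List.infix_cons_iff, ih h₁.2, List.cons_prefix_cons]
    simp [h₁.1]

theorem List.pair_infix_append_cons_right_iff {α : Type*} {y v : α} {l₁ l₂ : List α}
    (h₁ : v ∉ l₁) (h₂ : v ∉ l₂) : [y, v] <:+: l₁ ++ v :: l₂ ↔ l₁.getLast? = some y := by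
  rw [← List.reverse_infix, ← List.head?_reverse,
    ← List.pair_infix_append_cons_left_iff (l₁ := l₂.reverse) (v := v) (by simpa using h₂)
      (by simpa using h₁)]
  simp

/-- Insertion of a letter `v`, to be thought of as smaller than all the letters of the tuple of
words `L`, such that it becomes a letter of word number `i`: the letter `v` is placed after
word number `i` if `a = 1` and before the following word if `d = 1`, and forms a word on its own
if `a = d = 0`. -/
def insertLetter (a d i v : ℕ) (L : List (List ℕ)) : List (List ℕ) :=
  L.take i ++ (((L.drop i).take a).flatten ++ v :: ((L.drop (i + a)).take d).flatten) ::
    L.drop (i + a + d)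

/-- The `h`-tuples of nonempty words on the letters `v, …, v + m - 1`, each used once. -/
def wordTuples : ℕ → ℕ → ℕ → Finset (List (List ℕ))
  | _, 0, h => if h = 0 then {[]} else ∅
  | v, m + 1, h => (Finset.range 2 ×ˢ Finset.range 2 ×ˢ Finset.range h).biUnion fun p =>
      (wordTuples (v + 1) m (h + p.1 + p.2.1 - 1)).image (insertLetter p.1 p.2.1 p.2.2 v)

theorem insertLetter_append {a d i v : ℕ} {X U V Z : List (List ℕ)} (hX : X.length = i)
    (hU : U.length = a) (hV : V.length = d) :
    insertLetter a d i v (X ++ U ++ V ++ Z) = X ++ (U.flatten ++ v :: V.flatten) :: Z := by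
  subst hX hU hV
  simp only [insertLetter, ← List.drop_drop, List.append_assoc, List.drop_left, List.take_left]

theorem exists_eq_append_of_length {a d i h : ℕ} {L : List (List ℕ)} (hi : i < h)
    (hL : L.length = h + a + d - 1) : ∃ X U V Z : List (List ℕ), L = X ++ U ++ V ++ Z ∧
      X.length = i ∧ U.length = a ∧ V.length = d := by
  refine ⟨L.take i, (L.drop i).take a, (L.drop (i + a)).take d, L.drop (i + a + d), ?_, ?_, ?_, ?_⟩
  · simp only [← List.drop_drop, List.append_assoc, List.take_append_drop]
  · rw [List.length_take]; omega
  · rw [List.length_take, List.length_drop]; omega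
  · rw [List.length_take, List.length_drop]; omega

theorem List.eq_of_flatten_eq_of_length_le_one {α : Type*} {U U' : List (List α)}
    (h : U.length ≤ 1) (h' : U'.length ≤ 1) (hU : [] ∉ U) (hU' : [] ∉ U')
    (he : U.flatten = U'.flatten) : U = U' := by
  rcases U with _ | ⟨u, _ | ⟨_, U⟩⟩ <;> rcases U' with _ | ⟨u', _ | ⟨_, U'⟩⟩ <;> simp_all

/-- Deleting the smallest letter `v` inverts insertion: the word containing `v` splits into the
parts before and after it, and empty parts are dropped. -/
theorem mem_wordTuples {v m h : ℕ} {L : List (List ℕ)} :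
    L ∈ wordTuples v m h ↔
      L.length = h ∧ [] ∉ L ∧ L.flatten.Perm (List.range' v m) := by
  induction m generalizing v h L with
  | zero =>
    rw [wordTuples]
    rcases L with _ | ⟨w, L⟩
    · by_cases hh : h = 0 <;> simp [hh, eq_comm]
    · by_cases hh : h = 0
      · simp [hh]
      · simp only [hh, if_false, Finset.notMem_empty, false_iff]
        rintro ⟨-, h2, h3⟩
        rw [List.range'_zero, List.perm_nil] at h3
        simp only [List.flatten_cons, List.append_eq_nil_iff] at h3
        exact h2 (by simp [h3.1])
  | succ m ih =>
    rw [wordTuples]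
    simp only [Finset.mem_biUnion, Finset.mem_image, Finset.mem_product, Finset.mem_range, ih]
    constructor
    · rintro ⟨⟨a, d, i⟩, ⟨ha, hd, hi⟩, L₀, ⟨h1, h2, h3⟩, rfl⟩
      obtain ⟨X, U, V, Z, rfl, hX, hU, hV⟩ := exists_eq_append_of_length hi h1
      rw [insertLetter_append hX hU hV]
      simp only [List.length_append] at h1
      simp only [List.mem_append, not_or] at h2
      refine ⟨?_, ?_, ?_⟩
      · simp only [List.length_append, List.length_cons]
        dsimp only at hi h1 hX hU hV
        omega
      · simp [h2]
      · rw [List.range'_succ]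
        refine List.Perm.trans ?_ (h3.cons v)
        simp only [List.flatten_append, List.flatten_cons, List.append_assoc, List.cons_append]
        rw [← List.append_assoc, ← List.append_assoc X.flatten]
        exact List.perm_middle
    · rintro ⟨h1, h2, h3⟩
      have hv : v ∈ L.flatten := h3.mem_iff.2 (by simp)
      obtain ⟨c, hc, hvc⟩ := List.mem_flatten.1 hv
      obtain ⟨X, Z, rfl⟩ := List.append_of_mem hc
      obtain ⟨u, w, rfl⟩ := List.append_of_mem hvc
      -- A possibly empty side of `v` is encoded as a list of zero or one nonempty words; its length
      -- is the parameter `a` (likewise `d` for the other side).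
      obtain ⟨U, hU1, hU2, hU3⟩ : ∃ U : List (List ℕ), U.length < 2 ∧ U.flatten = u ∧ [] ∉ U := by
        by_cases hu : u = []
        · exact ⟨[], by simp [hu]⟩
        · exact ⟨[u], by simp [Ne.symm hu]⟩
      obtain ⟨W, hW1, hW2, hW3⟩ : ∃ U : List (List ℕ), U.length < 2 ∧ U.flatten = w ∧ [] ∉ U := by
        by_cases hu : w = []
        · exact ⟨[], by simp [hu]⟩
        · exact ⟨[w], by simp [Ne.symm hu]⟩
      subst hU2 hW2
      simp only [List.length_append, List.length_cons] at h1
      simp only [List.mem_append, List.mem_cons, not_or] at h2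
      refine ⟨⟨U.length, W.length, X.length⟩, ⟨hU1, hW1, by dsimp only; omega⟩, X ++ U ++ W ++ Z,
        ⟨?_, ?_, ?_⟩, insertLetter_append rfl rfl rfl⟩
      · simp only [List.length_append]
        omega
      · simp [h2, hU3, hW3]
      · rw [List.range'_succ] at h3
        refine List.Perm.cons_inv (List.Perm.trans ?_ h3)
        simp only [List.flatten_append, List.flatten_cons, List.append_assoc, List.cons_append]
        rw [← List.append_assoc X.flatten U.flatten, ← List.append_assoc X.flatten U.flatten]
        exact List.perm_middle.symm

/-- Normal form for the positional arguments below: `U` and `V` are the words glued before and after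
`v`, and every letter present exceeds `v`. -/
theorem exists_eq_append_of_mem_wordTuples {a d i v m h : ℕ} {L : List (List ℕ)} (hi : i < h)
    (hL : L ∈ wordTuples (v + 1) m (h + a + d - 1)) : ∃ X U V Z : List (List ℕ),
      L = X ++ U ++ V ++ Z ∧ X.length = i ∧ U.length = a ∧ V.length = d ∧ [] ∉ U ∧ [] ∉ V ∧
      (∀ x ∈ L.flatten, v < x) ∧ v ∉ X.flatten ∧ v ∉ U.flatten ∧ v ∉ V.flatten ∧ v ∉ Z.flatten := by
  obtain ⟨h1, h2, h3⟩ := mem_wordTuples.1 hL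
  obtain ⟨X, U, V, Z, rfl, hX, hU, hV⟩ := exists_eq_append_of_length hi h1
  have h4 : ∀ x ∈ (X ++ U ++ V ++ Z).flatten, v < x := fun x hx => by
    have := h3.mem_iff.1 hx
    rw [List.mem_range'_1] at this
    omega
  have h5 : v ∉ (X ++ U ++ V ++ Z).flatten := fun h => lt_irrefl _ (h4 v h)
  rw [List.flatten_append, List.flatten_append, List.flatten_append] at h5
  simp only [List.mem_append, not_or] at h2 h5
  exact ⟨X, U, V, Z, rfl, hX, hU, hV, h2.1.1.2, h2.1.2, h4, h5.1.1.1, h5.1.1.2, h5.1.2, h5.2⟩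

theorem insertLetter_inj {a d i a' d' i' v m h : ℕ} {L L' : List (List ℕ)} (ha : a < 2)
    (hd : d < 2) (hi : i < h) (ha' : a' < 2) (hd' : d' < 2) (hi' : i' < h)
    (hL : L ∈ wordTuples (v + 1) m (h + a + d - 1))
    (hL' : L' ∈ wordTuples (v + 1) m (h + a' + d' - 1))
    (he : insertLetter a d i v L = insertLetter a' d' i' v L') :
    a = a' ∧ d = d' ∧ i = i' ∧ L = L' := by
  obtain ⟨X, U, V, Z, rfl, hX, hU, hV, hU0, hV0, -, vX, vU, vV, vZ⟩ :=
    exists_eq_append_of_mem_wordTuples hi hL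
  obtain ⟨X', U', V', Z', rfl, hX', hU', hV', hU0', hV0', -, vX', vU', vV', vZ'⟩ :=
    exists_eq_append_of_mem_wordTuples hi' hL'
  rw [insertLetter_append hX hU hV, insertLetter_append hX' hU' hV'] at he
  obtain ⟨rfl, e2, rfl⟩ := List.append_cons_inj_of_forall_not (v ∈ ·)
    (fun x hx hv => vX (List.mem_flatten.2 ⟨x, hx, hv⟩))
    (fun x hx hv => vX' (List.mem_flatten.2 ⟨x, hx, hv⟩)) (by simp) (by simp) he
  obtain ⟨e3, -, e4⟩ := List.append_cons_inj_of_forall_not (· = v)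
    (fun x hx hv => vU (hv ▸ hx)) (fun x hx hv => vU' (hv ▸ hx)) rfl rfl e2
  obtain rfl := List.eq_of_flatten_eq_of_length_le_one (by omega) (by omega) hU0 hU0' e3
  obtain rfl := List.eq_of_flatten_eq_of_length_le_one (by omega) (by omega) hV0 hV0' e4
  exact ⟨hU.symm.trans hU', hV.symm.trans hV', hX.symm.trans hX', rfl⟩

theorem sum_wordTuples_succ (v m h : ℕ) (F : List (List ℕ) → ℕ) :
    ∑ L ∈ wordTuples v (m + 1) h, F L =
      ∑ a ∈ Finset.range 2, ∑ d ∈ Finset.range 2, ∑ i ∈ Finset.range h,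
        ∑ L ∈ wordTuples (v + 1) m (h + a + d - 1), F (insertLetter a d i v L) := by
  rw [wordTuples, Finset.sum_biUnion, Finset.sum_product]
  · refine Finset.sum_congr rfl fun a ha => ?_
    rw [Finset.sum_product]
    refine Finset.sum_congr rfl fun d hd => Finset.sum_congr rfl fun i hi => ?_
    rw [Finset.mem_range] at ha hd hi
    exact Finset.sum_image fun L hL L' hL' he =>
      (insertLetter_inj ha hd hi ha hd hi hL hL' he).2.2.2
  · rintro ⟨a, d, i⟩ hp ⟨a', d', i'⟩ hp' hne
    rw [Function.onFun, Finset.disjoint_left]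
    intro L hL hL'
    obtain ⟨L₁, h1, rfl⟩ := Finset.mem_image.1 hL
    obtain ⟨L₂, h2, he⟩ := Finset.mem_image.1 hL'
    simp only [Finset.coe_product, Set.mem_prod, Finset.mem_coe, Finset.mem_range] at hp hp'
    obtain ⟨rfl, rfl, rfl, -⟩ :=
      insertLetter_inj hp'.1 hp'.2.1 hp'.2.2 hp.1 hp.2.1 hp.2.2 h2 h1 he
    exact hne rfl

/-! ### Ordinal types and blocks under insertion. -/

/-- The letters `x` and `y` are consecutive in one of the words of `L`. -/
def Consecutive (L : List (List ℕ)) (x y : ℕ) : Prop := ∃ w ∈ L, [x, y] <:+: w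

/-- The letter `x` is preceded by a larger one in `L`. -/
def LargerBefore (L : List (List ℕ)) (x : ℕ) : Prop := ∃ y, x < y ∧ Consecutive L y x

/-- The letter `x` is followed by a larger one in `L`. -/
def LargerAfter (L : List (List ℕ)) (x : ℕ) : Prop := ∃ y, x < y ∧ Consecutive L x y

/-- The letters `x, x + 1, x + 2` form a factor of `L`, in this order or in the reverse one. -/
def IsBlock (L : List (List ℕ)) (x : ℕ) : Prop :=
  (Consecutive L x (x + 1) ∧ Consecutive L (x + 1) (x + 2)) ∨
    (Consecutive L (x + 2) (x + 1) ∧ Consecutive L (x + 1) x)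

/-- The letters `x, x + 1, x + 2` have the same ordinal type in `L`. -/
def SameType (L : List (List ℕ)) (x : ℕ) : Prop :=
  ((LargerBefore L x ↔ LargerBefore L (x + 1)) ∧ (LargerBefore L x ↔ LargerBefore L (x + 2))) ∧
    (LargerAfter L x ↔ LargerAfter L (x + 1)) ∧ (LargerAfter L x ↔ LargerAfter L (x + 2))

open Classical in
/-- The number of ways to polarize the letters `x, x + 1, x + 2` of `L`, which is `0` if their
types are not the same. -/
noncomputable def blockWeight (L : List (List ℕ)) (x : ℕ) : ℕ :=
  if SameType L x then if IsBlock L x then 2 else 1 else 0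

section insertLetter

variable {a d i v m h : ℕ} {L : List (List ℕ)}

theorem consecutive_append_iff {X Z : List (List ℕ)} {x y : ℕ} :
    Consecutive (X ++ Z) x y ↔ Consecutive X x y ∨ Consecutive Z x y := by
  simp only [Consecutive, List.mem_append, or_and_right, exists_or]

theorem consecutive_cons_iff {w : List ℕ} {Z : List (List ℕ)} {x y : ℕ} :
    Consecutive (w :: Z) x y ↔ [x, y] <:+: w ∨ Consecutive Z x y := by
  simp only [Consecutive, List.mem_cons, or_and_right, exists_or, exists_eq_left]

theorem Consecutive.mem_left {x y : ℕ} (hL : Consecutive L x y) : x ∈ L.flatten := by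
  obtain ⟨w, hw, hxy⟩ := hL
  exact List.mem_flatten.2 ⟨w, hw, hxy.subset (by simp)⟩

theorem Consecutive.mem_right {x y : ℕ} (hL : Consecutive L x y) : y ∈ L.flatten := by
  obtain ⟨w, hw, hxy⟩ := hL
  exact List.mem_flatten.2 ⟨w, hw, hxy.subset (by simp)⟩

theorem consecutive_iff_flatten {U : List (List ℕ)} (hU : U.length ≤ 1) {x y : ℕ} :
    Consecutive U x y ↔ [x, y] <:+: U.flatten := by
  rcases U with _ | ⟨u, _ | ⟨_, U⟩⟩
  · simp [Consecutive]
  · simp [Consecutive]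
  · simp at hU

/-- Words are joined only through `v`, so no adjacency between the other letters appears or
disappears. Hence types and blocks of larger letters, once formed, are final. -/
theorem consecutive_insertLetter_of_ne (ha : a < 2) (hd : d < 2) (hi : i < h)
    (hL : L ∈ wordTuples (v + 1) m (h + a + d - 1)) {x y : ℕ} (hx : x ≠ v) (hy : y ≠ v) :
    Consecutive (insertLetter a d i v L) x y ↔ Consecutive L x y := by
  obtain ⟨X, U, V, Z, rfl, hX, hU, hV, -⟩ := exists_eq_append_of_mem_wordTuples hi hL
  rw [insertLetter_append hX hU hV, consecutive_append_iff, consecutive_cons_iff,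
    List.pair_infix_append_cons_iff hx hy, consecutive_append_iff, consecutive_append_iff,
    consecutive_append_iff, consecutive_iff_flatten (U := U) (by omega),
    consecutive_iff_flatten (U := V) (by omega)]
  tauto

theorem consecutive_insertLetter_left (hi : i < h)
    (hL : L ∈ wordTuples (v + 1) m (h + a + d - 1)) {y : ℕ} :
    Consecutive (insertLetter a d i v L) v y ↔
      ((L.drop (i + a)).take d).flatten.head? = some y := by
  obtain ⟨X, U, V, Z, rfl, rfl, rfl, rfl, -, -, -, vX, vU, vV, vZ⟩ :=
    exists_eq_append_of_mem_wordTuples hi hL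
  rw [insertLetter_append rfl rfl rfl, consecutive_append_iff, consecutive_cons_iff,
    List.pair_infix_append_cons_left_iff vU vV]
  have hX : ¬ Consecutive X v y := fun hc => vX hc.mem_left
  have hZ : ¬ Consecutive Z v y := fun hc => vZ hc.mem_left
  simp only [← List.drop_drop, List.append_assoc, List.drop_left, List.take_left, hX, hZ, false_or,
    or_false]

theorem consecutive_insertLetter_right (hi : i < h)
    (hL : L ∈ wordTuples (v + 1) m (h + a + d - 1)) {y : ℕ} :
    Consecutive (insertLetter a d i v L) y v ↔
      ((L.drop i).take a).flatten.getLast? = some y := by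
  obtain ⟨X, U, V, Z, rfl, rfl, rfl, rfl, -, -, -, vX, vU, vV, vZ⟩ :=
    exists_eq_append_of_mem_wordTuples hi hL
  rw [insertLetter_append rfl rfl rfl, consecutive_append_iff, consecutive_cons_iff,
    List.pair_infix_append_cons_right_iff vU vV]
  have hX : ¬ Consecutive X y v := fun hc => vX hc.mem_right
  have hZ : ¬ Consecutive Z y v := fun hc => vZ hc.mem_right
  simp only [List.append_assoc, List.drop_left, List.take_left, hX, hZ, false_or, or_false]

/-- What follows `v` in its word is empty or a nonempty word of larger letters, according to `d`. -/
theorem largerAfter_insertLetter_self (hd : d < 2) (hi : i < h)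
    (hL : L ∈ wordTuples (v + 1) m (h + a + d - 1)) :
    LargerAfter (insertLetter a d i v L) v ↔ d = 1 := by
  simp only [LargerAfter, consecutive_insertLetter_left hi hL]
  obtain ⟨X, U, V, Z, rfl, rfl, rfl, rfl, -, hV, hlt, -⟩ :=
    exists_eq_append_of_mem_wordTuples hi hL
  simp only [← List.drop_drop, List.append_assoc, List.drop_left, List.take_left]
  rcases V with _ | ⟨_ | ⟨y, V⟩, _ | ⟨_, W⟩⟩
  · simp
  · simp at hV
  · simp at hV
  · simpa using hlt y (by simp)
  · simp at hd

theorem largerBefore_insertLetter_self (ha : a < 2) (hi : i < h)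
    (hL : L ∈ wordTuples (v + 1) m (h + a + d - 1)) :
    LargerBefore (insertLetter a d i v L) v ↔ a = 1 := by
  simp only [LargerBefore, consecutive_insertLetter_right hi hL]
  obtain ⟨X, U, V, Z, rfl, rfl, rfl, rfl, hU, -, hlt, -⟩ :=
    exists_eq_append_of_mem_wordTuples hi hL
  simp only [List.append_assoc, List.drop_left, List.take_left]
  rcases U with _ | ⟨u, _ | ⟨_, W⟩⟩
  · simp
  · rcases u.eq_nil_or_concat with rfl | ⟨w, y, rfl⟩
    · simp at hU
    simpa using hlt y (by simp)
  · simp at ha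

theorem largerAfter_insertLetter_of_lt (ha : a < 2) (hd : d < 2) (hi : i < h)
    (hL : L ∈ wordTuples (v + 1) m (h + a + d - 1)) {x : ℕ} (hx : v < x) :
    LargerAfter (insertLetter a d i v L) x ↔ LargerAfter L x :=
  exists_congr fun _ => and_congr_right fun hy =>
    consecutive_insertLetter_of_ne ha hd hi hL hx.ne' (hx.trans hy).ne'

theorem largerBefore_insertLetter_of_lt (ha : a < 2) (hd : d < 2) (hi : i < h)
    (hL : L ∈ wordTuples (v + 1) m (h + a + d - 1)) {x : ℕ} (hx : v < x) :
    LargerBefore (insertLetter a d i v L) x ↔ LargerBefore L x :=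
  exists_congr fun _ => and_congr_right fun hy =>
    consecutive_insertLetter_of_ne ha hd hi hL (hx.trans hy).ne' hx.ne'

theorem blockWeight_insertLetter_of_lt (ha : a < 2) (hd : d < 2) (hi : i < h)
    (hL : L ∈ wordTuples (v + 1) m (h + a + d - 1)) {x : ℕ} (hx : v < x) :
    blockWeight (insertLetter a d i v L) x = blockWeight L x := by
  have h1 : SameType (insertLetter a d i v L) x ↔ SameType L x := by
    rw [SameType, SameType, largerAfter_insertLetter_of_lt ha hd hi hL hx,
      largerAfter_insertLetter_of_lt ha hd hi hL (x := x + 1) (by omega),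
      largerAfter_insertLetter_of_lt ha hd hi hL (x := x + 2) (by omega),
      largerBefore_insertLetter_of_lt ha hd hi hL hx,
      largerBefore_insertLetter_of_lt ha hd hi hL (x := x + 1) (by omega),
      largerBefore_insertLetter_of_lt ha hd hi hL (x := x + 2) (by omega)]
  have h2 : IsBlock (insertLetter a d i v L) x ↔ IsBlock L x := by
    have h3 : ∀ j k : ℕ, Consecutive (insertLetter a d i v L) (x + j) (x + k) ↔
        Consecutive L (x + j) (x + k) := fun j k =>
      consecutive_insertLetter_of_ne ha hd hi hL (by omega) (by omega)
    rw [IsBlock, IsBlock]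
    exact or_congr (and_congr (h3 0 1) (h3 1 2)) (and_congr (h3 2 1) (h3 1 0))
  classical
  rw [blockWeight, blockWeight]
  exact if_congr h1 (if_congr h2 rfl rfl) rfl

theorem List.eq_length_of_getElem?_append_cons {α : Type*} {X Z : List (List α)} {c w : List α}
    {v : α} {j : ℕ} (hX : v ∉ X.flatten) (hZ : v ∉ Z.flatten)
    (hj : (X ++ c :: Z)[j]? = some w) (hv : v ∈ w) : j = X.length := by
  rcases lt_trichotomy j X.length with h1 | h1 | h1
  · rw [List.getElem?_append_left h1] at hj
    exact absurd (List.mem_flatten.2 ⟨w, List.mem_of_getElem? hj, hv⟩) hX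
  · exact h1
  · rw [List.getElem?_append_right h1.le, List.getElem?_cons,
      if_neg (by omega)] at hj
    exact absurd (List.mem_flatten.2 ⟨w, List.mem_of_getElem? hj, hv⟩) hZ

theorem List.flatten_take_one_drop {α : Type*} (L : List (List α)) (j : ℕ) :
    ((L.drop j).take 1).flatten = (L[j]?).getD [] := by
  rw [List.take_one, List.head?_drop]
  cases L[j]? <;> simp

/-- Serves to decide whether the next inserted letter, placed before word `j`, becomes adjacent to
`v`: that word must be the one of `v`, with nothing glued in front of `v`. -/
theorem head?_insertLetter_iff (hi : i < h)
    (hL : L ∈ wordTuples (v + 1) m (h + a + d - 1)) {d' j : ℕ} (hd' : d' < 2) :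
    (((insertLetter a d i v L).drop j).take d').flatten.head? = some v ↔
      d' = 1 ∧ a = 0 ∧ j = i := by
  obtain ⟨X, U, V, Z, rfl, rfl, rfl, rfl, hU, hV, hlt, vX, vU, vV, vZ⟩ :=
    exists_eq_append_of_mem_wordTuples hi hL
  rw [insertLetter_append rfl rfl rfl]
  interval_cases d'
  · simp
  rw [List.flatten_take_one_drop]
  constructor
  · intro h1
    obtain ⟨w, hw⟩ : ∃ w, (X ++ (U.flatten ++ v :: V.flatten) :: Z)[j]? = some w := by
      rw [← Option.ne_none_iff_exists']
      intro h2
      simp [h2] at h1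
    rw [hw, Option.getD_some] at h1
    obtain rfl := List.eq_length_of_getElem?_append_cons vX vZ hw (List.mem_of_head? h1)
    refine ⟨rfl, ?_, rfl⟩
    rw [List.getElem?_append_right le_rfl, Nat.sub_self, List.getElem?_cons_zero,
      Option.some.injEq] at hw
    subst hw
    rcases U with _ | ⟨_ | ⟨y, u⟩, U⟩
    · rfl
    · simp at hU
    · simp at h1 vU
      exact absurd h1.symm vU.1
  · rintro ⟨-, h1, rfl⟩
    rw [List.length_eq_zero_iff] at h1
    simp [h1]

theorem getLast?_insertLetter_iff (hi : i < h)
    (hL : L ∈ wordTuples (v + 1) m (h + a + d - 1)) {a' j : ℕ} (ha' : a' < 2) :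
    (((insertLetter a d i v L).drop j).take a').flatten.getLast? = some v ↔
      a' = 1 ∧ d = 0 ∧ j = i := by
  obtain ⟨X, U, V, Z, rfl, rfl, rfl, rfl, hU, hV, hlt, vX, vU, vV, vZ⟩ :=
    exists_eq_append_of_mem_wordTuples hi hL
  rw [insertLetter_append rfl rfl rfl]
  interval_cases a'
  · simp
  rw [List.flatten_take_one_drop]
  constructor
  · intro h1
    obtain ⟨w, hw⟩ : ∃ w, (X ++ (U.flatten ++ v :: V.flatten) :: Z)[j]? = some w := by
      rw [← Option.ne_none_iff_exists']
      intro h2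
      simp [h2] at h1
    rw [hw, Option.getD_some] at h1
    obtain rfl := List.eq_length_of_getElem?_append_cons vX vZ hw (List.mem_of_getLast? h1)
    refine ⟨rfl, ?_, rfl⟩
    rw [List.getElem?_append_right le_rfl, Nat.sub_self, List.getElem?_cons_zero,
      Option.some.injEq] at hw
    subst hw
    rcases V.eq_nil_or_concat with rfl | ⟨V, w, rfl⟩
    · rfl
    rcases w.eq_nil_or_concat with rfl | ⟨w, y, rfl⟩
    · simp at hV
    · simp [List.getLast?_append, List.getLast?_cons] at h1 vV
      exact absurd h1.symm vV.2.2
  · rintro ⟨-, h1, rfl⟩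
    rw [List.length_eq_zero_iff] at h1
    simp [h1]

theorem insertLetter_mem_wordTuples (ha : a < 2) (hd : d < 2) (hi : i < h)
    (hL : L ∈ wordTuples (v + 1) m (h + a + d - 1)) :
    insertLetter a d i v L ∈ wordTuples v (m + 1) h := by
  rw [wordTuples, Finset.mem_biUnion]
  exact ⟨(a, d, i), by simp [ha, hd, hi], Finset.mem_image_of_mem _ hL⟩

/-- The order `v, v + 1` occurs iff `d = 1`, `a₁ = 0` and `i₁ = i`, and symmetrically for the
reverse order. With constant type, a block therefore needs `a ≠ d` and equal word numbers. -/
theorem blockWeight_insertLetter_three {a₁ d₁ i₁ a₂ d₂ i₂ : ℕ} (ha : a < 2) (hd : d < 2)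
    (hi : i < h) (ha₁ : a₁ < 2) (hd₁ : d₁ < 2) (hi₁ : i₁ < h + a + d - 1) (ha₂ : a₂ < 2)
    (hd₂ : d₂ < 2) (hi₂ : i₂ < h + a + d - 1 + a₁ + d₁ - 1)
    (hL : L ∈ wordTuples (v + 1 + 1 + 1) m (h + a + d - 1 + a₁ + d₁ - 1 + a₂ + d₂ - 1)) :
    blockWeight (insertLetter a d i v (insertLetter a₁ d₁ i₁ (v + 1)
      (insertLetter a₂ d₂ i₂ (v + 1 + 1) L))) v =
      if (a₁ = a ∧ a₂ = a) ∧ d₁ = d ∧ d₂ = d then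
        if a ≠ d ∧ i₁ = i ∧ i₂ = i then 2 else 1 else 0 := by
  have hL₁ := insertLetter_mem_wordTuples ha₂ hd₂ hi₂ hL
  have hL₂ := insertLetter_mem_wordTuples ha₁ hd₁ hi₁ hL₁
  simp only [blockWeight, SameType, IsBlock, show v + 2 = v + 1 + 1 from rfl,
    largerAfter_insertLetter_self hd hi hL₂, largerBefore_insertLetter_self ha hi hL₂,
    largerAfter_insertLetter_of_lt ha hd hi hL₂ (show v < v + 1 by omega),
    largerBefore_insertLetter_of_lt ha hd hi hL₂ (show v < v + 1 by omega),
    largerAfter_insertLetter_of_lt ha hd hi hL₂ (show v < v + 1 + 1 by omega),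
    largerBefore_insertLetter_of_lt ha hd hi hL₂ (show v < v + 1 + 1 by omega),
    largerAfter_insertLetter_self hd₁ hi₁ hL₁, largerBefore_insertLetter_self ha₁ hi₁ hL₁,
    largerAfter_insertLetter_of_lt ha₁ hd₁ hi₁ hL₁ (show v + 1 < v + 1 + 1 by omega),
    largerBefore_insertLetter_of_lt ha₁ hd₁ hi₁ hL₁ (show v + 1 < v + 1 + 1 by omega),
    largerAfter_insertLetter_self hd₂ hi₂ hL, largerBefore_insertLetter_self ha₂ hi₂ hL,
    consecutive_insertLetter_of_ne ha hd hi hL₂ (show v + 1 ≠ v by omega)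
      (show v + 1 + 1 ≠ v by omega),
    consecutive_insertLetter_of_ne ha hd hi hL₂ (show v + 1 + 1 ≠ v by omega)
      (show v + 1 ≠ v by omega),
    consecutive_insertLetter_left hi hL₂, consecutive_insertLetter_right hi hL₂,
    consecutive_insertLetter_left hi₁ hL₁, consecutive_insertLetter_right hi₁ hL₁,
    head?_insertLetter_iff hi₁ hL₁ hd, getLast?_insertLetter_iff hi₁ hL₁ ha,
    head?_insertLetter_iff hi₂ hL hd₁, getLast?_insertLetter_iff hi₂ hL ha₁]
  split_ifs <;> omega

end insertLetter

/-! ### The weighted count of word tuples. -/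

theorem sum_range_three_diagonal (h w : ℕ) :
    ∑ i ∈ Finset.range h, ∑ j ∈ Finset.range h, ∑ k ∈ Finset.range h,
      w * (if j = i ∧ k = i then 2 else 1) = h * (h * h + 1) * w := by
  have h1 : ∀ i j k : ℕ, w * (if j = i ∧ k = i then 2 else 1) =
      w + if j = i then if k = i then w else 0 else 0 := fun i j k => by
    split_ifs <;> omega
  have h2 : ∀ i ∈ Finset.range h, ∑ j ∈ Finset.range h, ∑ k ∈ Finset.range h,
      w * (if j = i ∧ k = i then 2 else 1) = h * (h * w) + w := fun i hi => by
    simp only [h1, Finset.sum_add_distrib, Finset.sum_const, Finset.card_range, smul_eq_mul]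
    rw [Finset.sum_eq_single i (fun j _ hj => by simp [hj]) (fun hn => absurd hi hn)]
    simp [Finset.mem_range.1 hi]
  rw [Finset.sum_congr rfl h2, Finset.sum_const, Finset.card_range, smul_eq_mul]
  ring

/-- Three insertions make one step of the path. The largest letter belongs to no complete block and
carries no weight; left alone, it forces height 1. -/
theorem sum_prod_blockWeight (n v h : ℕ) :
    ∑ L ∈ wordTuples v (3 * n + 1) h, ∏ k ∈ Finset.range n, blockWeight L (v + 3 * k) =
      pathWeight n h := by
  induction n generalizing v h with
  | zero =>
    simp only [Finset.range_zero, Finset.prod_empty]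
    rw [mul_zero, zero_add, sum_wordTuples_succ]
    simp only [wordTuples, pathWeight, Finset.sum_range_succ, Finset.sum_range_zero]
    rcases h with _ | _ | h <;> simp
  | succ n ih =>
    rw [show 3 * (n + 1) + 1 = 3 * n + 1 + 1 + 1 + 1 by ring, sum_wordTuples_succ]
    simp only [sum_wordTuples_succ _ (_ + 1)]
    trans ∑ a ∈ Finset.range 2, ∑ d ∈ Finset.range 2, ∑ i ∈ Finset.range h,
      ∑ a₁ ∈ Finset.range 2, ∑ d₁ ∈ Finset.range 2, ∑ i₁ ∈ Finset.range (h + a + d - 1),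
      ∑ a₂ ∈ Finset.range 2, ∑ d₂ ∈ Finset.range 2,
      ∑ i₂ ∈ Finset.range (h + a + d - 1 + a₁ + d₁ - 1),
      pathWeight n (h + a + d - 1 + a₁ + d₁ - 1 + a₂ + d₂ - 1) *
        (if (a₁ = a ∧ a₂ = a) ∧ d₁ = d ∧ d₂ = d then
          if a ≠ d ∧ i₁ = i ∧ i₂ = i then 2 else 1 else 0)
    · refine Finset.sum_congr rfl fun a ha => Finset.sum_congr rfl fun d hd =>
        Finset.sum_congr rfl fun i hi => Finset.sum_congr rfl fun a₁ ha₁ =>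
        Finset.sum_congr rfl fun d₁ hd₁ => Finset.sum_congr rfl fun i₁ hi₁ =>
        Finset.sum_congr rfl fun a₂ ha₂ => Finset.sum_congr rfl fun d₂ hd₂ =>
        Finset.sum_congr rfl fun i₂ hi₂ => ?_
      rw [Finset.mem_range] at ha hd hi ha₁ hd₁ hi₁ ha₂ hd₂ hi₂
      rw [← ih (v + 1 + 1 + 1), Finset.sum_mul]
      refine Finset.sum_congr rfl fun L hL => ?_
      have hL₁ := insertLetter_mem_wordTuples ha₂ hd₂ hi₂ hL
      have hL₂ := insertLetter_mem_wordTuples ha₁ hd₁ hi₁ hL₁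
      rw [Finset.prod_range_succ', mul_zero, add_zero,
        blockWeight_insertLetter_three ha hd hi ha₁ hd₁ hi₁ ha₂ hd₂ hi₂ hL]
      congr 1
      refine Finset.prod_congr rfl fun k _ => ?_
      rw [blockWeight_insertLetter_of_lt ha hd hi hL₂ (by omega),
        blockWeight_insertLetter_of_lt ha₁ hd₁ hi₁ hL₁ (by omega),
        blockWeight_insertLetter_of_lt ha₂ hd₂ hi₂ hL (by omega)]
      congr 1
      ring
    -- Only constant types survive: `(0,0)` and `(1,1)` give the steps -3 and +3, while `(0,1)` and
    -- `(1,0)` give the two equal level contributions.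
    · have h2 : ∀ x, x + 2 - 1 = x + 1 := fun _ => rfl
      simp only [Finset.sum_range_succ, Finset.sum_range_zero, zero_add, add_zero, mul_zero,
        zero_ne_one, one_ne_zero, ne_eq, and_true, true_and, and_false, false_and, not_true,
        not_false_eq_true, if_true, if_false, mul_one, Finset.sum_const_zero, Finset.sum_const,
        Finset.card_range, smul_eq_mul, Nat.add_sub_cancel, sum_range_three_diagonal,
        Nat.sub_sub, pathWeight, Nat.add_assoc, Nat.reduceAdd, h2]
      ring

/-! ### From permutations to one-word tuples. -/

theorem List.pair_infix_iff_getElem? {α : Type*} {x y : α} {w : List α} :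
    [x, y] <:+: w ↔ ∃ i : ℕ, w[i]? = some x ∧ w[i + 1]? = some y := by
  constructor
  · rintro ⟨s, t, rfl⟩
    refine ⟨s.length, ?_, ?_⟩ <;> simp
  · rintro ⟨i, h1, h2⟩
    obtain ⟨hi1, h3⟩ := List.getElem?_eq_some_iff.1 h1
    obtain ⟨hi2, h4⟩ := List.getElem?_eq_some_iff.1 h2
    refine ⟨w.take i, w.drop (i + 2), ?_⟩
    rw [List.append_assoc, List.cons_append, List.cons_append, List.nil_append, ← h3, ← h4,
      List.getElem_cons_drop, List.getElem_cons_drop, List.take_append_drop]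

/-- The permutation `σ` as a word on the letters `1, …, n`. -/
def permWord {n : ℕ} (σ : Equiv.Perm (Fin n)) : List ℕ := List.ofFn fun i => (σ i : ℕ) + 1

section borderedWord

variable {n : ℕ} {σ : Equiv.Perm (Fin n)}

theorem borderedWord_eq_coe_iff {j v : ℕ} :
    borderedWord σ j = (v : WithBot ℕ) ↔ ∃ i : Fin n, j = i + 1 ∧ v = σ i + 1 := by
  rw [borderedWord]
  split_ifs with h
  · rw [Nat.cast_inj]
    constructor
    · rintro rfl
      exact ⟨⟨j - 1, by omega⟩, by simp; omega, rfl⟩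
    · rintro ⟨i, rfl, rfl⟩
      rfl
  · refine ⟨fun h' => absurd h' (WithBot.bot_ne_coe), ?_⟩
    rintro ⟨i, rfl, rfl⟩
    exact absurd ⟨by omega, i.2⟩ h

theorem borderedWord_inj {j j' v : ℕ} (h : borderedWord σ j = (v : WithBot ℕ))
    (h' : borderedWord σ j' = (v : WithBot ℕ)) : j = j' := by
  obtain ⟨i, rfl, rfl⟩ := borderedWord_eq_coe_iff.1 h
  obtain ⟨i', rfl, h2⟩ := borderedWord_eq_coe_iff.1 h'
  rw [σ.injective (Fin.ext (Nat.succ_injective h2))]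

theorem exists_borderedWord_eq {v : ℕ} (h1 : 1 ≤ v) (h2 : v ≤ n) :
    ∃ j, borderedWord σ j = (v : WithBot ℕ) := by
  refine ⟨(σ.symm ⟨v - 1, by omega⟩ : ℕ) + 1, borderedWord_eq_coe_iff.2 ⟨_, rfl, ?_⟩⟩
  simp
  omega

theorem consecutive_permWord_iff {x y : ℕ} : Consecutive [permWord σ] x y ↔
    ∃ j, borderedWord σ j = (x : WithBot ℕ) ∧ borderedWord σ (j + 1) = (y : WithBot ℕ) := by
  have h1 : ∀ i v : ℕ, (permWord σ)[i]? = some v ↔ borderedWord σ (i + 1) = (v : WithBot ℕ) := by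
    intro i v
    rw [borderedWord_eq_coe_iff, List.getElem?_eq_some_iff]
    constructor
    · rintro ⟨hi, h⟩
      rw [permWord, List.length_ofFn] at hi
      exact ⟨⟨i, hi⟩, rfl, by simpa [permWord] using h.symm⟩
    · rintro ⟨k, h, rfl⟩
      obtain rfl : i = k := by omega
      exact ⟨by simp [permWord], by simp [permWord]⟩
  simp only [Consecutive, List.mem_singleton, exists_eq_left, List.pair_infix_iff_getElem?, h1]
  refine ⟨fun ⟨i, hi⟩ => ⟨i + 1, hi⟩, fun ⟨j, hj⟩ => ?_⟩
  obtain ⟨k, rfl, -⟩ := borderedWord_eq_coe_iff.1 hj.1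
  exact ⟨k, hj⟩

theorem largerAfter_permWord_iff {j v : ℕ} (hj : borderedWord σ j = (v : WithBot ℕ)) :
    (LargerAfter [permWord σ] v ↔ borderedWord σ j < borderedWord σ (j + 1)) ∧
      (¬LargerAfter [permWord σ] v ↔ borderedWord σ (j + 1) < borderedWord σ j) := by
  have h1 : LargerAfter [permWord σ] v ↔ borderedWord σ j < borderedWord σ (j + 1) := by
    simp only [LargerAfter, consecutive_permWord_iff]
    constructor
    · rintro ⟨y, hy, i, hi, hi'⟩
      obtain rfl := borderedWord_inj hj hi
      rw [hi, hi']
      exact WithBot.coe_lt_coe.2 hy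
    · intro h
      obtain ⟨y, hy⟩ := WithBot.ne_bot_iff_exists.1 (ne_bot_of_gt h)
      rw [hj, ← hy] at h
      exact ⟨y, WithBot.coe_lt_coe.1 h, j, hj, hy.symm⟩
  refine ⟨h1, ?_⟩
  -- Equality is excluded because a letter occurs at only one position; the absence of a larger
  -- neighbour thus means a smaller one or the border.
  rw [h1, not_lt, le_iff_lt_or_eq, or_iff_left]
  intro h
  have := borderedWord_inj hj (h.trans hj)
  omega

theorem largerBefore_permWord_iff {j v : ℕ} (hj : borderedWord σ j = (v : WithBot ℕ)) :
    (LargerBefore [permWord σ] v ↔ borderedWord σ j < borderedWord σ (j - 1)) ∧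
      (¬LargerBefore [permWord σ] v ↔ borderedWord σ (j - 1) < borderedWord σ j) := by
  obtain ⟨k, hk, -⟩ := borderedWord_eq_coe_iff.1 hj
  have h1 : LargerBefore [permWord σ] v ↔ borderedWord σ j < borderedWord σ (j - 1) := by
    simp only [LargerBefore, consecutive_permWord_iff]
    constructor
    · rintro ⟨y, hy, i, hi, hi'⟩
      obtain rfl := borderedWord_inj hj hi'
      rw [hi', Nat.add_sub_cancel, hi]
      exact WithBot.coe_lt_coe.2 hy
    · intro h
      obtain ⟨y, hy⟩ := WithBot.ne_bot_iff_exists.1 (ne_bot_of_gt h)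
      rw [hj, ← hy] at h
      exact ⟨y, WithBot.coe_lt_coe.1 h, j - 1, hy.symm, by rwa [Nat.sub_add_cancel (by omega)]⟩
  refine ⟨h1, ?_⟩
  rw [h1, not_lt, le_iff_lt_or_eq, or_iff_left]
  intro h
  have := borderedWord_inj hj (h.trans hj)
  omega

theorem hasOrdinalType_iff {j v : ℕ} (hj : borderedWord σ j = (v : WithBot ℕ)) (t : OrdinalType) :
    HasOrdinalType σ j t ↔
      (LargerBefore [permWord σ] v ↔ t = .valley ∨ t = .doubleFall) ∧
        (LargerAfter [permWord σ] v ↔ t = .valley ∨ t = .doubleRise) := by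
  cases t <;>
  simp [HasOrdinalType, ← (largerAfter_permWord_iff hj).1, ← (largerAfter_permWord_iff hj).2,
    ← (largerBefore_permWord_iff hj).1, ← (largerBefore_permWord_iff hj).2]

/-- Since the length is `3m + 1`, the block `k = m` contains a single value and later blocks are
empty, so only `k < m` imposes a condition. -/
theorem isRepeated_three_iff {m : ℕ} {σ : Equiv.Perm (Fin (3 * m + 1))} :
    IsRepeated 3 σ ↔ ∀ k < m, SameType [permWord σ] (1 + 3 * k) := by
  constructor
  · intro h k hk
    obtain ⟨t, ht⟩ := h k
    have h1 : ∀ v, k * 3 + 1 ≤ v → v ≤ k * 3 + 3 →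
        (LargerBefore [permWord σ] v ↔ t = .valley ∨ t = .doubleFall) ∧
        (LargerAfter [permWord σ] v ↔ t = .valley ∨ t = .doubleRise) := by
      intro v hv1 hv2
      obtain ⟨j, hj⟩ := exists_borderedWord_eq (σ := σ) (v := v) (by omega) (by omega)
      exact (hasOrdinalType_iff hj t).1 (ht j v hj hv1 hv2)
    rw [SameType, (h1 (1 + 3 * k) (by omega) (by omega)).1,
      (h1 (1 + 3 * k) (by omega) (by omega)).2, (h1 (1 + 3 * k + 1) (by omega) (by omega)).1,
      (h1 (1 + 3 * k + 1) (by omega) (by omega)).2, (h1 (1 + 3 * k + 2) (by omega) (by omega)).1,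
      (h1 (1 + 3 * k + 2) (by omega) (by omega)).2]
    simp
  · intro h k
    have h1 : ∀ v, k * 3 + 1 ≤ v → v ≤ k * 3 + 3 → v ≤ 3 * m + 1 →
        (LargerBefore [permWord σ] (1 + 3 * k) ↔ LargerBefore [permWord σ] v) ∧
        (LargerAfter [permWord σ] (1 + 3 * k) ↔ LargerAfter [permWord σ] v) := by
      intro v hv1 hv2 hv3
      by_cases hk : k < m
      · obtain ⟨⟨h2, h3⟩, h4, h5⟩ := h k hk
        obtain rfl | rfl | rfl : v = 1 + 3 * k ∨ v = 1 + 3 * k + 1 ∨ v = 1 + 3 * k + 2 := by omega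
        · simp
        · exact ⟨h2, h4⟩
        · exact ⟨h3, h5⟩
      · obtain rfl : v = 1 + 3 * k := by omega
        simp
    obtain ⟨t, ht⟩ : ∃ t : OrdinalType,
        (LargerBefore [permWord σ] (1 + 3 * k) ↔ t = .valley ∨ t = .doubleFall) ∧
        (LargerAfter [permWord σ] (1 + 3 * k) ↔ t = .valley ∨ t = .doubleRise) := by
      by_cases hb : LargerBefore [permWord σ] (1 + 3 * k) <;>
        by_cases ha : LargerAfter [permWord σ] (1 + 3 * k)
      · exact ⟨.valley, by simp [hb, ha]⟩
      · exact ⟨.doubleFall, by simp [hb, ha]⟩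
      · exact ⟨.doubleRise, by simp [hb, ha]⟩
      · exact ⟨.peak, by simp [hb, ha]⟩
    refine ⟨t, fun j v hj hv1 hv2 => (hasOrdinalType_iff hj t).2 ?_⟩
    obtain ⟨i, -, rfl⟩ := borderedWord_eq_coe_iff.1 hj
    obtain ⟨h2, h3⟩ := h1 _ hv1 hv2 (σ i).2
    rwa [← h2, ← h3]

theorem isBlock_permWord_iff {x : ℕ} : IsBlock [permWord σ] x ↔ ∃ j,
    (borderedWord σ j = ((x + 2 : ℕ) : WithBot ℕ) ∧
      borderedWord σ (j + 1) = ((x + 1 : ℕ) : WithBot ℕ) ∧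
      borderedWord σ (j + 2) = (x : WithBot ℕ)) ∨
    (borderedWord σ j = (x : WithBot ℕ) ∧
      borderedWord σ (j + 1) = ((x + 1 : ℕ) : WithBot ℕ) ∧
      borderedWord σ (j + 2) = ((x + 2 : ℕ) : WithBot ℕ)) := by
  simp only [IsBlock, consecutive_permWord_iff]
  constructor
  · rintro (⟨⟨j, h1, h2⟩, j', h3, h4⟩ | ⟨⟨j, h1, h2⟩, j', h3, h4⟩)
    · obtain rfl := borderedWord_inj h2 h3
      exact ⟨j, Or.inr ⟨h1, h2, h4⟩⟩
    · obtain rfl := borderedWord_inj h2 h3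
      exact ⟨j, Or.inl ⟨h1, h2, h4⟩⟩
  · rintro ⟨j, ⟨h1, h2, h3⟩ | ⟨h1, h2, h3⟩⟩
    · exact Or.inr ⟨⟨j, h1, h2⟩, j + 1, h2, h3⟩
    · exact Or.inl ⟨⟨j, h1, h2⟩, j + 1, h2, h3⟩

open Classical in
-- A markable position is matched with its block number `σ i / 3`, as `σ i` is `3k` or `3k + 2`. The
-- map is injective because in both orders the middle letter `3k + 2` follows the starting position.
theorem card_isMarkable {m : ℕ} (σ : Equiv.Perm (Fin (3 * m + 1))) :
    (Finset.univ.filter fun i => IsMarkable σ i).card =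
      ((Finset.range m).filter fun k => IsBlock [permWord σ] (1 + 3 * k)).card := by
  have h0 : ∀ (i : Fin (3 * m + 1)) (v : ℕ),
      borderedWord σ (i + 1) = (v : WithBot ℕ) → v = σ i + 1 := by
    intro i v h
    obtain ⟨i', h1, rfl⟩ := borderedWord_eq_coe_iff.1 h
    rw [Fin.ext (Nat.succ_injective h1)]
  have h1 : ∀ i, IsMarkable σ i → IsBlock [permWord σ] (1 + 3 * (σ i / 3)) ∧ (σ i : ℕ) / 3 < m ∧
      borderedWord σ (i + 2) = ((3 * (σ i / 3) + 2 : ℕ) : WithBot ℕ) := by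
    rintro i ⟨k, hk⟩
    have h2 : (σ i : ℕ) / 3 = k := by
      rcases hk with ⟨h, -⟩ | ⟨h, -⟩
      · have := h0 i _ h
        omega
      · have := h0 i _ h
        omega
    rw [h2]
    refine ⟨isBlock_permWord_iff.2 ⟨i + 1, ?_⟩, ?_, ?_⟩
    · rwa [show 1 + 3 * k + 2 = 3 * k + 3 by ring, show 1 + 3 * k + 1 = 3 * k + 2 by ring,
        show 1 + 3 * k = 3 * k + 1 by ring]
    · rcases hk with ⟨h, -⟩ | ⟨-, -, h⟩
      · obtain ⟨i', -, h3⟩ := borderedWord_eq_coe_iff.1 h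
        have := (σ i').2
        omega
      · obtain ⟨i', -, h3⟩ := borderedWord_eq_coe_iff.1 h
        have := (σ i').2
        omega
    · rcases hk with ⟨-, h, -⟩ | ⟨-, h, -⟩ <;> exact h
  refine Finset.card_bij (fun i _ => (σ i : ℕ) / 3) (fun i hi => ?_) (fun i hi i' hi' h => ?_)
    (fun k hk => ?_)
  · rw [Finset.mem_filter] at hi ⊢
    exact ⟨Finset.mem_range.2 (h1 i hi.2).2.1, (h1 i hi.2).1⟩
  · rw [Finset.mem_filter] at hi hi'
    have h2 := (h1 i hi.2).2.2
    rw [h] at h2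
    have := borderedWord_inj h2 (h1 i' hi'.2).2.2
    exact Fin.ext (by omega)
  · rw [Finset.mem_filter, isBlock_permWord_iff] at hk
    obtain ⟨-, j, hj⟩ := hk
    obtain ⟨i, rfl⟩ : ∃ i : Fin (3 * m + 1), j = i + 1 := by
      rcases hj with ⟨h, -⟩ | ⟨h, -⟩
      · obtain ⟨i, h, -⟩ := borderedWord_eq_coe_iff.1 h
        exact ⟨i, h⟩
      · obtain ⟨i, h, -⟩ := borderedWord_eq_coe_iff.1 h
        exact ⟨i, h⟩
    refine ⟨i, Finset.mem_filter.2 ⟨Finset.mem_univ _, k, ?_⟩, ?_⟩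
    · rwa [show 1 + 3 * k + 2 = 3 * k + 3 by ring, show 1 + 3 * k + 1 = 3 * k + 2 by ring,
        show 1 + 3 * k = 3 * k + 1 by ring] at hj
    · rcases hj with ⟨h, -⟩ | ⟨h, -⟩
      · have := h0 i _ h
        omega
      · have := h0 i _ h
        omega

open Classical in
theorem prod_blockWeight_permWord {m : ℕ} (σ : Equiv.Perm (Fin (3 * m + 1))) :
    ∏ k ∈ Finset.range m, blockWeight [permWord σ] (1 + 3 * k) =
      if IsRepeated 3 σ then 2 ^ (Finset.univ.filter fun i => IsMarkable σ i).card else 0 := by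
  split_ifs with h
  · rw [isRepeated_three_iff] at h
    rw [card_isMarkable, ← Finset.prod_const, Finset.prod_filter]
    refine Finset.prod_congr rfl fun k hk => ?_
    rw [blockWeight, if_pos (h k (Finset.mem_range.1 hk))]
  · rw [isRepeated_three_iff] at h
    push Not at h
    obtain ⟨k, hk, hs⟩ := h
    exact Finset.prod_eq_zero (Finset.mem_range.2 hk) (by rw [blockWeight, if_neg hs])

/-- The hypothesis `n ≠ 0` matters: words in a tuple are nonempty, so the empty permutation has no
counterpart. -/
theorem sum_permWord (n : ℕ) (F : List (List ℕ) → ℕ)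
    (hn : n ≠ 0) : ∑ σ : Equiv.Perm (Fin n), F [permWord σ] = ∑ L ∈ wordTuples 1 n 1, F L := by
  refine Finset.sum_bij (fun σ _ => [permWord σ]) (fun σ _ => ?_) (fun σ _ τ _ h => ?_)
    (fun L hL => ?_) (fun _ _ => rfl)
  · rw [mem_wordTuples]
    refine ⟨rfl, ?_, ?_⟩
    · rw [List.mem_singleton]
      intro h
      have h1 := congrArg List.length h
      rw [permWord, List.length_ofFn] at h1
      exact hn h1.symm
    · rw [List.flatten_singleton, List.perm_ext_iff_of_nodup _ List.nodup_range']
      · intro x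
        rw [permWord, List.mem_ofFn, List.mem_range'_1]
        constructor
        · rintro ⟨i, rfl⟩
          have := (σ i).2
          omega
        · rintro ⟨h1, h2⟩
          exact ⟨σ.symm ⟨x - 1, by omega⟩, by simp; omega⟩
      · exact List.nodup_ofFn.2 fun i j hij => σ.injective (Fin.ext (Nat.succ_injective hij))
  · rw [List.singleton_inj] at h
    have h1 := List.ofFn_injective h
    exact Equiv.ext fun i => Fin.ext (Nat.succ_injective (congrFun h1 i))
  · obtain ⟨h1, -, h3⟩ := mem_wordTuples.1 hL
    obtain ⟨w, rfl⟩ := List.length_eq_one_iff.1 h1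
    rw [List.flatten_singleton] at h3
    have hlen : w.length = n := by rw [h3.length_eq, List.length_range']
    have hmem : ∀ i : Fin n, 1 ≤ w[i] ∧ w[i] < 1 + n := fun i =>
      List.mem_range'_1.1 (h3.mem_iff.1 (List.getElem_mem _))
    let f : Fin n → Fin n := fun i => ⟨w[i] - 1, by have := hmem i; omega⟩
    have hf : Function.Injective f := fun i j hij => by
      have h4 := Fin.mk.inj_iff.1 hij
      have h5 : w[i] = w[j] := by
        have h6 := hmem i
        have h7 := hmem j
        omega
      exact Fin.ext ((h3.nodup_iff.2 List.nodup_range').getElem_inj_iff.1 h5)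
    refine ⟨Equiv.ofBijective f (Finite.injective_iff_bijective.1 hf), Finset.mem_univ _, ?_⟩
    congr 1
    refine List.ext_getElem (by simp [permWord, hlen]) fun i hi hi' => ?_
    have := (hmem ⟨i, by omega⟩).1
    simp only [permWord, List.getElem_ofFn, Equiv.ofBijective_apply, f]
    exact Nat.sub_add_cancel this

theorem card_polarizedPerm (m : ℕ) :
    Nat.card (PolarizedPerm (3 * m + 1)) = pathWeight m 1 := by
  classical
  rw [← sum_prod_blockWeight m 1 1, ← sum_permWord _ _ (Nat.succ_ne_zero _), PolarizedPerm, Nat.card_eq_fintype_card,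
    Fintype.card_subtype, Finset.card_filter, Fintype.sum_prod_type]
  refine Finset.sum_congr rfl fun σ _ => ?_
  rw [prod_blockWeight_permWord]
  split_ifs with h
  -- The admissible sets of marks are the subsets of the markable positions, hence the power of 2.
  · rw [← Finset.card_powerset, ← Finset.card_filter]
    congr 1
    ext M
    simp [h, Finset.subset_iff]
  · simp [h]

end borderedWord

/-! ### Conclusion: comparison of coefficients. -/

theorem coeff_smhSeries_eq_card (n : ℕ) :
    PowerSeries.coeff n smhSeries = (Nat.card (PolarizedPerm n) : ℚ) / (n ! : ℚ) := by
  by_cases hn : n % 3 = 1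
  · obtain ⟨m, rfl⟩ : ∃ m, n = 3 * m + 1 := ⟨n / 3, by omega⟩
    rw [card_polarizedPerm, ← coeff_smhSeries_pow_mul_factorial, pow_one,
      mul_div_cancel_right₀ _ (by exact_mod_cast Nat.factorial_ne_zero _)]
  · have : IsEmpty (PolarizedPerm n) := ⟨fun p => by
      obtain ⟨m, hm⟩ := p.2.1
      omega⟩
    rw [coeff_smhSeries, (dixonCoeff_eq_zero n).1 hn, Nat.card_of_isEmpty]
    simp

theorem mainTheorem5 :
    expGenFun (fun n => Nat.card (PolarizedPerm n)) = smhSeries ∧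
      ∀ s c : ℂ → ℂ, IsDixonPair s c →
        ∀ᶠ z in 𝓝 (0 : ℂ),
          HasSum (fun n : ℕ => (Nat.card (PolarizedPerm n) : ℂ) / (n ! : ℂ) * z ^ n)
            (-s (-z)) := by
  refine ⟨?_, fun s c h => h.hasSum_smhSeries.mono fun z hz => ?_⟩
  · ext n
    rw [expGenFun, PowerSeries.coeff_mk, coeff_smhSeries_eq_card]
  · simpa [coeff_smhSeries_eq_card] using hz
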